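/- Let $q\equiv 3\pmod 4$ be a power of a prime $p$, let $\mathbb F_q\subset\mathbb F_{q^2}$ be the fields with $q$ and $q^2$ elements, and let $N:\mathbb F_{q^2}\to\mathbb F_q$, $N(z)=z^{q+1}$, be the norm. Multiplicative characters are complex-valued and extended by $0$ at $0$, the trivial one included; $\varepsilon$ and $\phi$ denote the trivial and the quadratic character of $\mathbb F_q$, and $\overline{D}$ is the complex conjugate (inverse) of $D$. For a character $C$ on $\mathbb F_q$, $CN$ denotes the character $C\circ N$ on $\mathbb F_{q^2}$. Let $M_8$ be a character of order $8$ on $\mathbb F_{q^2}$. Put $$\psi(y)=\exp\Big(\frac{2\pi i}{p}\big(y^p+y^{p^2}+\dots+y^q\big)\Big),\qquad G(A)=\sum_{y\in\mathbb F_q}A(y)\psi(y),$$ for characters $A$ on $\mathbb F_q$, and $J_2(\alpha,\beta)=\sum_{z\in\mathbb F_{q^2}}\alpha(z)\beta(1-z)$ for characters $\alpha,\beta$ on $\mathbb F_{q^2}$. For a character $D$ on $\mathbb F_q$ and $j\in\mathbb F_q^*$, define $$h(D,j)=\sum_{x\in\mathbb F_q^*}D(x)\,\phi(1-x)\,\phi\overline{D}^2\big(x(j+1)^2+(j-1)^2\big).$$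 Let $\nu_1$ be any character on $\mathbb F_q$, and define $$W(D)=\sum_{j\in\mathbb F_q^*}\phi\nu_1^4(j)\,h(D,j).$$ **Theorem 5.3.** We have $W(\varepsilon)=2$, and for every nontrivial character $D$ on $\mathbb F_q$, $$W(D)=\frac{-G(\phi)G(D)^2}{q\,G(\phi D^2)}\Big\{J_2\big((\nu_1N)M_8,\ \overline{D}N\big)+J_2\big((\nu_1N)M_8^5,\ \overline{D}N\big)\Big\}.$$ -/

import Mathlib

/-- The additive character `ψ(y) = exp((2πi/p) · Tr(y))` on a finite field `F` of
characteristic `p`, where `Tr(y) = y ^ p + y ^ (p ^ 2) + ⋯ + y ^ q` is the absolute trace. -/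
noncomputable def psi (p : ℕ) [Fact p.Prime] (F : Type*) [Field F] [Algebra (ZMod p) F] :
    AddChar F ℂ :=
  (ZMod.stdAddChar (N := p)).compAddMonoidHom
    (Algebra.trace (ZMod p) F : F →ₗ[ZMod p] ZMod p).toAddMonoidHom

/-- The Gauss sum `G(A) = ∑ y, A(y) ψ(y)` over `F`. -/
noncomputable def gaussG (p : ℕ) [Fact p.Prime] {F : Type*} [Field F] [Fintype F]
    [Algebra (ZMod p) F] (A : MulChar F ℂ) : ℂ :=
  gaussSum A (psi p F)

/-- The quadratic character `φ` of `F`, with complex values. -/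
noncomputable def phi (F : Type*) [Field F] [Fintype F] [DecidableEq F] : MulChar F ℂ :=
  (quadraticChar F).ringHomComp (Int.castRingHom ℂ)

/-- For a character `C` on `F`, the character `CN` on a finite extension `K`, obtained by
composing `C` with the norm map from `K` to `F`. -/
noncomputable def normChar {F : Type*} [Field F] (K : Type*) [Field K] [Algebra F K]
    [FiniteDimensional F K] (C : MulChar F ℂ) : MulChar K ℂ where
  toMonoidHom := (C : F →* ℂ).comp (Algebra.norm F : K →* F)
  map_nonunit' z hz := by
    have h0 : z = 0 := by simpa using hz
    subst h0
    simpa using C.map_zero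

/-- The character sum
`h(D, j) = ∑_{x ∈ F^*} D(x) φ(1 - x) (φ D̄²)(x (j + 1)² + (j - 1)²)`.
The conjugate character `D̄` is the inverse of `D` in the group of characters. -/
noncomputable def hSum {F : Type*} [Field F] [Fintype F] [DecidableEq F]
    (D : MulChar F ℂ) (j : Fˣ) : ℂ :=
  ∑ x : Fˣ, D x * phi F (1 - x) *
    (phi F * D⁻¹ ^ 2) (x * ((j : F) + 1) ^ 2 + ((j : F) - 1) ^ 2)

/-- The weighted sum `W(D) = ∑_{j ∈ F^*} (φ ν₁⁴)(j) h(D, j)`. -/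
noncomputable def wSum {F : Type*} [Field F] [Fintype F] [DecidableEq F]
    (ν₁ D : MulChar F ℂ) : ℂ :=
  ∑ j : Fˣ, (phi F * ν₁ ^ 4) j * hSum D j

/-! For nontrivial `D`, expanding in Gauss sums turns `h(D, j)` into a multiple of
`∑ x, φ(x) D̄(((j + 1)² - 4x)((j - 1)² + 4x))`, by a factor independent of `j`.

On the other side, Frobenius of `K/F` fixes `ν₁N` and `D̄N` and sends `{M₈, M₈⁵}` to `{M₈³, M₈⁷}`.
Twice the sum of the two Jacobi sums is thus the sum of all four `J₂(ν₁N M₈ (M₈²)ⁱ, D̄N)`, and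
summing over the powers of the quartic character `M₈²` gives `∑ s, (φν₁⁴)(N s) D̄(N(1 - s⁴))`.
Since `-1` is not a square in `F`, one writes `s = x + y i` with `i² = -1`; then `N s = x² + y²`,
and `N(1 - s⁴)` is a symmetric polynomial in `X = x²` and `Y = y²` that is invariant under
`(X, Y) ↦ (-X, -Y)`. As `φν₁⁴` is odd, only the terms `φ(X)` and `φ(Y)` of `(1 + φ(X))(1 + φ(Y))`
survive, and `j = X + Y` recovers the sum above.
-/

theorem sum_units_eq_sum_sub {G A : Type*} [GroupWithZero G] [Fintype G] [Fintype Gˣ]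
    [AddCommGroup A] (f : G → A) : ∑ u : Gˣ, f u = ∑ x, f x - f 0 := by
  classical
  rw [← Finset.sum_erase_eq_sub (Finset.mem_univ _)]
  exact Finset.sum_bij (fun u _ => (u : G)) (by simp) (fun _ _ _ _ => Units.ext)
    (fun x hx => ⟨Units.mk0 x (Finset.ne_of_mem_erase hx), by simp⟩) (fun _ _ => rfl)

theorem card_pow_eq_card_nthRoots {R : Type*} [CommRing R] [IsDomain R] [Fintype R]
    [DecidableEq R] {n : ℕ} [NeZero n] {ζ : R} (hζ : IsPrimitiveRoot ζ n) {a : R} (ha : a ≠ 0) :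
    Finset.card {s | s ^ n = a} = (Polynomial.nthRoots n a).card := by
  rw [← Multiset.toFinset_card_of_nodup (hζ.nthRoots_nodup ha)]
  congr 1
  ext s
  simp [Polynomial.mem_nthRoots (NeZero.pos n)]

theorem orderOf_apply_generator {M R : Type*} [CommMonoid M] [CommMonoidWithZero R]
    {g : Mˣ} (hg : ∀ u, u ∈ Subgroup.zpowers g) (χ : MulChar M R) :
    orderOf (χ g) = orderOf χ :=
  orderOf_eq_orderOf_iff.2 fun n => by
    rw [MulChar.eq_iff hg, MulChar.pow_apply_coe, MulChar.one_apply_coe]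

section Characters

variable {F R : Type*} [Field F] [Finite F] [CommRing R]

theorem exists_isPrimitiveRoot_orderOf (χ : MulChar F R) :
    ∃ ζ : F, IsPrimitiveRoot ζ (orderOf χ) := by
  obtain ⟨g, hg⟩ := IsCyclic.exists_generator (α := Fˣ)
  obtain ⟨m, hm⟩ : orderOf χ ∣ orderOf (g : F) := by
    rw [orderOf_dvd_iff_pow_eq_one, MulChar.eq_iff hg, MulChar.pow_apply_coe, ← map_pow,
      pow_orderOf_eq_one, MulChar.map_one, MulChar.one_apply_coe]
  have hpos : 0 < orderOf (g : F) := by rw [orderOf_units]; exact orderOf_pos g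
  exact ⟨g ^ m, (IsPrimitiveRoot.orderOf (g : F)).pow hpos (by rw [hm, mul_comm])⟩

theorem apply_eq_one_iff_exists_pow_orderOf_eq (χ : MulChar F R) {z : F} (hz : z ≠ 0) :
    χ z = 1 ↔ ∃ s, s ^ orderOf χ = z := by
  constructor
  · intro h
    obtain ⟨g, hg⟩ := IsCyclic.exists_generator (α := Fˣ)
    obtain ⟨k, hk : g ^ k = Units.mk0 z hz⟩ :=
      mem_powers_iff_mem_zpowers.2 (hg (Units.mk0 z hz))
    replace hk : (g : F) ^ k = z := by simpa using congrArg Units.val hk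
    obtain ⟨m, rfl⟩ : orderOf χ ∣ k := by
      rw [← orderOf_apply_generator hg, orderOf_dvd_iff_pow_eq_one, ← map_pow, hk, h]
    exact ⟨g ^ m, by rw [← hk, ← pow_mul, mul_comm]⟩
  · rintro ⟨s, rfl⟩
    rw [map_pow, ← MulChar.pow_apply' χ χ.orderOf_pos.ne', pow_orderOf_eq_one,
      MulChar.one_apply (ne_zero_pow χ.orderOf_pos.ne' hz).isUnit]

theorem eq_of_orderOf_eq_two [IsDomain R] {χ η : MulChar F R} (hχ : orderOf χ = 2)
    (hη : orderOf η = 2) : χ = η := by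
  obtain ⟨g, hg⟩ := IsCyclic.exists_generator (α := Fˣ)
  have apply_generator {ρ : MulChar F R} (hρ : orderOf ρ = 2) : ρ g = -1 := by
    obtain ⟨hsq, hne⟩ := orderOf_eq_prime_iff.1 ((orderOf_apply_generator hg ρ).trans hρ)
    exact (sq_eq_one_iff.1 hsq).resolve_left hne
  rw [MulChar.eq_iff hg, apply_generator hχ, apply_generator hη]

end Characters

section CharacterSums

variable {F R : Type*} [Field F] [Fintype F] [CommRing R] [IsDomain R]

theorem sum_mulChar_mul_addChar {χ : MulChar F R} (hχ : χ ≠ 1) (ψ : AddChar F R) (c : F) :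
    ∑ x, χ x * ψ (c * x) = χ⁻¹ c * gaussSum χ ψ := by
  rcases eq_or_ne c 0 with rfl | hc
  · simpa [MulChar.map_zero] using MulChar.sum_eq_zero_of_ne_one hχ
  · simpa [gaussSum] using gaussSum_mulShift_eq χ ψ (Units.mk0 c hc)

theorem card_pow_orderOf_eq [DecidableEq F] (χ : MulChar F R) (z : F) :
    (Finset.card {s | s ^ orderOf χ = z} : R) = ∑ i ∈ Finset.range (orderOf χ), χ z ^ i := by
  have hn := χ.orderOf_pos
  rcases eq_or_ne z 0 with rfl | hz
  · simp [hn.ne', MulChar.map_zero, zero_pow_eq, Finset.sum_ite_eq', Finset.filter_eq', hn]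
  obtain ⟨ζ, hζ⟩ := exists_isPrimitiveRoot_orderOf χ
  have : NeZero (orderOf χ) := ⟨hn.ne'⟩
  rw [card_pow_eq_card_nthRoots hζ hz, hζ.card_nthRoots]
  split_ifs with h <;> rw [← apply_eq_one_iff_exists_pow_orderOf_eq χ hz] at h
  · simp [h]
  · rw [Nat.cast_zero]
    refine (mul_left_cancel₀ (sub_ne_zero.2 h) ?_).symm
    rw [mul_geom_sum, ← MulChar.pow_apply' χ hn.ne', pow_orderOf_eq_one,
      MulChar.one_apply hz.isUnit, sub_self, mul_zero]

theorem sum_comp_pow_orderOf (χ : MulChar F R) (f : F → R) :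
    ∑ s, f (s ^ orderOf χ) = ∑ z, (∑ i ∈ Finset.range (orderOf χ), χ z ^ i) * f z := by
  classical
  rw [← Finset.sum_fiberwise Finset.univ (fun s : F => s ^ orderOf χ)]
  refine Finset.sum_congr rfl fun z _ => ?_
  rw [← card_pow_orderOf_eq, Finset.sum_congr rfl fun s hs => by rw [(Finset.mem_filter.1 hs).2],
    Finset.sum_const, nsmul_eq_mul]

theorem sum_jacobiSum_mul_pow (χ β ρ : MulChar F R) :
    ∑ i ∈ Finset.range (orderOf ρ), jacobiSum (χ * ρ ^ i) β =
      ∑ s, χ (s ^ orderOf ρ) * β (1 - s ^ orderOf ρ) := by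
  rw [sum_comp_pow_orderOf ρ fun z => χ z * β (1 - z)]
  simp only [jacobiSum, Finset.sum_mul]
  rw [Finset.sum_comm]
  refine Finset.sum_congr rfl fun z _ => Finset.sum_congr rfl fun i _ => ?_
  rcases eq_or_ne z 0 with rfl | hz
  · simp [MulChar.map_zero]
  · rw [MulChar.mul_apply, show (ρ ^ i) z = ρ z ^ i from ρ.pow_apply_coe i (Units.mk0 z hz)]
    ring

theorem sum_mulChar_one_sub_mul_inv {χ : MulChar F R} (hχ : χ ≠ 1) {a b : F} (hab : a + b ≠ 0) :
    ∑ x, χ (1 - x) * χ⁻¹ (x * a + b) = -χ⁻¹ (-a) := by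
  rcases eq_or_ne a 0 with rfl | ha
  · have h := (Equiv.subLeft (1 : F)).sum_comp χ
    simp only [Equiv.subLeft_apply, MulChar.sum_eq_zero_of_ne_one hχ] at h
    simp [MulChar.map_zero, ← Finset.sum_mul, h]
  have hc : (a + b) / a ≠ 0 := div_ne_zero hab ha
  -- `x = 1 - ((a + b) / a) y` turns the sum into a multiple of `J(χ, χ⁻¹)`
  rw [← ((Equiv.mulLeft₀ _ hc).trans (Equiv.subLeft 1)).sum_comp]
  calc _ = ∑ y, χ⁻¹ a * (χ y * χ⁻¹ (1 - y)) := Finset.sum_congr rfl fun y _ => by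
        simp only [Equiv.trans_apply, Equiv.subLeft_apply, Equiv.mulLeft₀_apply, sub_sub_cancel]
        rw [show (1 - (a + b) / a * y) * a + b = (a + b) * (1 - y) by field_simp; ring,
          map_mul, map_mul, div_eq_mul_inv, map_mul, ← MulChar.inv_apply' χ a]
        have h : χ (a + b) * χ⁻¹ (a + b) = 1 := by
          rw [← MulChar.mul_apply, mul_inv_cancel, MulChar.one_apply hab.isUnit]
        linear_combination χ⁻¹ a * χ y * χ⁻¹ (1 - y) * h
    _ = _ := by
        rw [← Finset.mul_sum, ← jacobiSum, jacobiSum_nontrivial_inv hχ, neg_eq_neg_one_mul a,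
          map_mul, MulChar.inv_apply' χ (-1), inv_neg_one]
        ring

end CharacterSums

section GaussSums

variable {F R : Type*} [Field F] [Fintype F] [CommRing R] [IsDomain R]

-- The sums over `x` in `gaussSum_mul_sum_eq_gaussSum_mul_sum` both unfold to this double sum over
-- `u` and `v`: one by the substitution `u = x v`, the other by opening `χ (v - u)` as a Gauss sum.
theorem sum_sum_eq_gaussSum_mul_sum {χ A B : MulChar F R} (hχAB : χ * A * B ≠ 1)
    (ψ : AddChar F R) (a b : F) :
    ∑ v, ∑ u, A u * B v * χ (v - u) * ψ (u * a + v * b) =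
      gaussSum (χ * A * B) ψ * ∑ x, A x * χ (1 - x) * (χ * A * B)⁻¹ (x * a + b) := by
  have expand (x : F) : gaussSum (χ * A * B) ψ * (A x * χ (1 - x) * (χ * A * B)⁻¹ (x * a + b)) =
      ∑ v, A x * χ (1 - x) * ((χ * A * B) v * ψ ((x * a + b) * v)) := by
    rw [← Finset.mul_sum, sum_mulChar_mul_addChar hχAB]
    ring
  rw [Finset.mul_sum, Finset.sum_congr rfl fun x _ => expand x]
  refine .trans (Finset.sum_congr rfl fun v _ => ?_) Finset.sum_comm
  rcases eq_or_ne v 0 with rfl | hv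
  · simp [MulChar.map_zero]
  rw [← Equiv.sum_comp (Equiv.mulRight₀ v hv)]
  refine Finset.sum_congr rfl fun x _ => ?_
  rw [Equiv.mulRight₀_apply, show v - x * v = (1 - x) * v by ring,
    show x * v * a + v * b = (x * a + b) * v by ring, map_mul A, map_mul χ, MulChar.mul_apply,
    MulChar.mul_apply]
  ring

theorem gaussSum_inv_mul_sum_sum {χ A B : MulChar F R} (hχ : χ ≠ 1) (hA : A ≠ 1) (hB : B ≠ 1)
    (ψ : AddChar F R) (a b : F) :
    gaussSum χ⁻¹ ψ * ∑ v, ∑ u, A u * B v * χ (v - u) * ψ (u * a + v * b) =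
      gaussSum A ψ * gaussSum B ψ * ∑ x, χ⁻¹ x * (A⁻¹ (a - x) * B⁻¹ (b + x)) := by
  have expand_left (u v : F) :
      gaussSum χ⁻¹ ψ * (A u * B v * χ (v - u) * ψ (u * a + v * b)) =
        ∑ x, A u * B v * ψ (u * a + v * b) * (χ⁻¹ x * ψ ((v - u) * x)) := by
    rw [← Finset.mul_sum, sum_mulChar_mul_addChar (inv_ne_one.2 hχ), inv_inv]
    ring
  have expand_right (x : F) :
      gaussSum A ψ * gaussSum B ψ * (χ⁻¹ x * (A⁻¹ (a - x) * B⁻¹ (b + x))) =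
        ∑ v, ∑ u, χ⁻¹ x * ((B v * ψ ((b + x) * v)) * (A u * ψ ((a - x) * u))) := by
    simp only [← Finset.mul_sum, ← Finset.sum_mul]
    rw [sum_mulChar_mul_addChar hA, sum_mulChar_mul_addChar hB]
    ring
  have separate (u v x : F) :
      ψ (u * a + v * b) * ψ ((v - u) * x) = ψ ((b + x) * v) * ψ ((a - x) * u) := by
    rw [← AddChar.map_add_eq_mul, ← AddChar.map_add_eq_mul]
    ring_nf
  simp only [Finset.mul_sum, expand_left, expand_right]
  refine .trans (Finset.sum_congr rfl fun v _ => ?_) Finset.sum_comm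
  refine Finset.sum_comm.trans (Finset.sum_congr rfl fun x _ => Finset.sum_congr rfl fun u _ => ?_)
  linear_combination A u * B v * χ⁻¹ x * separate u v x

theorem gaussSum_mul_sum_eq_gaussSum_mul_sum {χ A B : MulChar F R} (hχ : χ ≠ 1) (hA : A ≠ 1)
    (hB : B ≠ 1) (hχAB : χ * A * B ≠ 1) (ψ : AddChar F R) (a b : F) :
    gaussSum χ⁻¹ ψ * gaussSum (χ * A * B) ψ *
        ∑ x, A x * χ (1 - x) * (χ * A * B)⁻¹ (x * a + b) =
      gaussSum A ψ * gaussSum B ψ * ∑ x, χ⁻¹ x * (A⁻¹ (a - x) * B⁻¹ (b + x)) := by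
  rw [mul_assoc, ← sum_sum_eq_gaussSum_mul_sum hχAB, gaussSum_inv_mul_sum_sum hχ hA hB]

end GaussSums

section NormChar

variable {F K : Type*} [Field F] [Field K] [Algebra F K]

section FiniteDimensional

variable [FiniteDimensional F K]

theorem normChar_apply (C : MulChar F ℂ) (z : K) :
    normChar K C z = C (Algebra.norm F z) := rfl

theorem normChar_pow_card [Fintype F] (C : MulChar F ℂ) :
    normChar K C ^ Fintype.card F = normChar K C := by
  ext z
  rw [MulChar.pow_apply_coe, normChar_apply, ← map_pow, FiniteField.pow_card]

end FiniteDimensional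

theorem orderOf_normChar [Finite K] (C : MulChar F ℂ) :
    orderOf (normChar K C) = orderOf C :=
  orderOf_eq_orderOf_iff.2 fun n => by
    simp only [MulChar.eq_one_iff, MulChar.pow_apply_coe, normChar_apply]
    exact (FiniteField.unitsMap_norm_surjective F K).forall (p := fun u : Fˣ => C u ^ n = 1) |>.symm

variable [Fintype F] [Fintype K]

theorem jacobiSum_pow_card {R : Type*} [CommRing R] (χ η : MulChar K R) :
    jacobiSum (χ ^ Fintype.card F) (η ^ Fintype.card F) = jacobiSum χ η := by
  let σ := FiniteField.frobeniusAlgEquivOfAlgebraic F K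
  have pow_card_apply (χ : MulChar K R) (z : K) : (χ ^ Fintype.card F) z = χ (σ z) := by
    rw [MulChar.pow_apply' χ Fintype.card_ne_zero, ← map_pow]
    rfl
  simp only [jacobiSum, pow_card_apply, map_sub, map_one]
  exact σ.toEquiv.sum_comp fun z => χ z * η (1 - z)

theorem jacobiSum_normChar_mul_pow_card (C E : MulChar F ℂ) (χ : MulChar K ℂ) :
    jacobiSum (normChar K C * χ ^ Fintype.card F) (normChar K E) =
      jacobiSum (normChar K C * χ) (normChar K E) := by
  rw [← jacobiSum_pow_card (F := F) (normChar K C * χ), mul_pow, normChar_pow_card,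
    normChar_pow_card]

theorem jacobiSum_normChar_mul_add_frobenius (hq : Fintype.card F % 4 = 3) {M : MulChar K ℂ}
    (hM : orderOf M = 8) (C E : MulChar F ℂ) :
    jacobiSum (normChar K C * M) (normChar K E) + jacobiSum (normChar K C * M ^ 5) (normChar K E) =
      jacobiSum (normChar K C * M ^ 3) (normChar K E) +
        jacobiSum (normChar K C * M ^ 7) (normChar K E) := by
  have pow_congr {m n : ℕ} (h : m % 8 = n % 8) : M ^ m = M ^ n := by
    rwa [pow_inj_mod, hM]
  rw [← jacobiSum_normChar_mul_pow_card C E M, ← jacobiSum_normChar_mul_pow_card C E (M ^ 5),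
    ← pow_mul]
  obtain h | h : Fintype.card F % 8 = 3 ∨ Fintype.card F % 8 = 7 := by omega
  · rw [pow_congr (show _ = 3 % 8 from h), pow_congr (show 5 * Fintype.card F % 8 = 7 % 8 by omega)]
  · rw [pow_congr (show _ = 7 % 8 from h), pow_congr (show 5 * Fintype.card F % 8 = 3 % 8 by omega),
      add_comm]

end NormChar

section QuadraticCharacter

variable {F : Type*} [Field F] [Fintype F]

theorem ringChar_ne_two_of_card (hq : Fintype.card F % 4 = 3) : ringChar F ≠ 2 := fun h => by
  have := FiniteField.even_card_of_char_two h
  omega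

variable [DecidableEq F]

theorem phi_isQuadratic : (phi F).IsQuadratic :=
  (quadraticChar_isQuadratic F).comp _

theorem orderOf_phi (hF : ringChar F ≠ 2) : orderOf (phi F) = 2 :=
  orderOf_eq_prime phi_isQuadratic.sq_eq_one
    ((MulChar.ringHomComp_ne_one_iff Int.cast_injective).2 (quadraticChar_ne_one hF))

theorem phi_ne_one (hF : ringChar F ≠ 2) : phi F ≠ 1 := fun h => by
  simpa [h] using orderOf_phi hF

theorem phi_apply_sq {a : F} (ha : a ≠ 0) : phi F (a ^ 2) = 1 := by
  simp [phi, quadraticChar_sq_one' ha]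

theorem phi_mul_sq_odd (hq : Fintype.card F % 4 = 3) (χ : MulChar F ℂ) :
    Function.Odd ⇑(phi F * χ ^ 2) := fun a => by
  have phi_neg_one : phi F (-1) = -1 := by
    simp [phi, quadraticChar_neg_one_iff_not_isSquare.2 fun h =>
      FiniteField.isSquare_neg_one_iff.1 h hq]
  rw [neg_eq_neg_one_mul a, map_mul, MulChar.mul_apply, phi_neg_one,
    MulChar.pow_apply' χ two_ne_zero, ← map_pow, neg_one_sq, map_one, mul_one, neg_one_mul]

theorem phi_odd (hq : Fintype.card F % 4 = 3) : Function.Odd (phi F) := by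
  simpa using phi_mul_sq_odd hq 1

theorem phi_mul_sq_ne_one (hq : Fintype.card F % 4 = 3) (χ : MulChar F ℂ) :
    phi F * χ ^ 2 ≠ 1 := fun h => by
  have := phi_mul_sq_odd hq χ 1
  rw [h, MulChar.one_apply isUnit_one.neg, map_one] at this
  norm_num at this

theorem phi_mul_pow_four_odd (hq : Fintype.card F % 4 = 3) (χ : MulChar F ℂ) :
    Function.Odd ⇑(phi F * χ ^ 4) := by
  rw [show χ ^ 4 = (χ ^ 2) ^ 2 from pow_mul χ 2 2]
  exact phi_mul_sq_odd hq (χ ^ 2)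

end QuadraticCharacter

section OddSums

variable {F R : Type*} [Field F] [Fintype F] [CommRing R] [IsDomain R] [CharZero R]

theorem sum_sum_comp_sq_of_odd {ρ : MulChar F R} (hρ : orderOf ρ = 2) (hρ_odd : Function.Odd ρ)
    {H : F → F → R} (hsymm : ∀ x y, H x y = H y x) (hodd : ∀ x y, H (-x) (-y) = -H x y) :
    ∑ x, ∑ y, H (x ^ 2) (y ^ 2) = 2 * ∑ x, ∑ y, ρ x * H x y := by
  have sum_comp_sq (f : F → R) : ∑ x, f (x ^ 2) = ∑ x, (1 + ρ x) * f x := by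
    simpa [hρ, Finset.sum_range_succ] using sum_comp_pow_orderOf ρ f
  have swap : ∑ x, ∑ y, ρ y * H x y = ∑ x, ∑ y, ρ x * H x y :=
    Finset.sum_comm.trans (by simp only [hsymm])
  have cancel : ∑ x, ∑ y, (1 + ρ x * ρ y) * H x y = 0 := by
    rw [← Fintype.sum_prod_type']
    refine Function.Odd.sum_eq_zero fun p => ?_
    rw [Prod.fst_neg, Prod.snd_neg, hodd, hρ_odd, hρ_odd]
    ring
  calc ∑ x, ∑ y, H (x ^ 2) (y ^ 2)
      = ∑ x, ∑ y, (1 + ρ x) * ((1 + ρ y) * H x y) := by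
        rw [sum_comp_sq fun x => ∑ y, H x (y ^ 2)]
        simp only [sum_comp_sq, Finset.mul_sum]
    _ = ∑ x, ∑ y, (1 + ρ x * ρ y) * H x y + (∑ x, ∑ y, ρ x * H x y + ∑ x, ∑ y, ρ y * H x y) := by
        simp only [← Finset.sum_add_distrib]
        exact Finset.sum_congr rfl fun x _ => Finset.sum_congr rfl fun y _ => by ring
    _ = 2 * ∑ x, ∑ y, ρ x * H x y := by rw [cancel, swap, zero_add, two_mul]

end OddSums

section QuadraticExtension

variable {F K : Type*} [Field F] [Field K] [Algebra F K]

theorem exists_sq_eq_neg_one [Finite F] [Finite K] (hK : Module.finrank F K = 2) :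
    ∃ i : K, i ^ 2 = -1 := by
  have := Fintype.ofFinite F
  have := Fintype.ofFinite K
  have h : Fintype.card K % 4 ≠ 3 := by
    rw [Module.card_eq_pow_finrank (K := F), hK, Nat.pow_mod]
    have := Nat.mod_lt (Fintype.card F) (show 0 < 4 by norm_num)
    interval_cases Fintype.card F % 4 <;> norm_num
  obtain ⟨i, hi⟩ := FiniteField.isSquare_neg_one_iff.2 h
  exact ⟨i, by rw [sq, hi]⟩

theorem bijective_algebraMap_add_mul [Finite F] [Finite K] (hK : Module.finrank F K = 2)
    {i : K} (hi : i ∉ Set.range (algebraMap F K)) :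
    Function.Bijective fun p : F × F => algebraMap F K p.1 + algebraMap F K p.2 * i := by
  refine (Nat.bijective_iff_injective_and_card _).2 ⟨?_, ?_⟩
  · rintro ⟨x, y⟩ ⟨x', y'⟩ (h : algebraMap F K x + _ = algebraMap F K x' + _)
    obtain rfl : y = y' := by
      by_contra hne
      have : algebraMap F K (y - y') ≠ 0 := by simpa [sub_eq_zero] using hne
      refine hi ⟨(x' - x) / (y - y'), ?_⟩
      rw [map_div₀, div_eq_iff this, map_sub, map_sub]
      linear_combination -h
    simpa using h
  · rw [Nat.card_prod, Module.natCard_eq_pow_finrank (K := F) (V := K), hK, sq]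

variable [Fintype F]

theorem notMem_range_algebraMap (hq : Fintype.card F % 4 = 3) {i : K} (hi : i ^ 2 = -1) :
    i ∉ Set.range (algebraMap F K) := by
  rintro ⟨a, rfl⟩
  refine FiniteField.isSquare_neg_one_iff.1 ⟨a, (algebraMap F K).injective ?_⟩ hq
  rw [map_mul, map_neg, map_one, ← sq, hi]

theorem norm_algebraMap_add_mul [Finite K] (hq : Fintype.card F % 4 = 3)
    (hK : Module.finrank F K = 2) {i : K} (hi : i ^ 2 = -1) (x y : F) :
    Algebra.norm F (algebraMap F K x + algebraMap F K y * i) = x ^ 2 + y ^ 2 := by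
  let σ := FiniteField.frobeniusAlgEquivOfAlgebraic F K
  have hσi : σ i = -i := by
    change i ^ Fintype.card F = -i
    rw [← Nat.div_add_mod (Fintype.card F) 4, hq, pow_add, pow_mul,
      show i ^ 4 = 1 by linear_combination (i ^ 2 - 1) * hi, one_pow]
    linear_combination i * hi
  have hnorm (w : K) : algebraMap F K (Algebra.norm F w) = σ w * w := by
    rw [FiniteField.algebraMap_norm_eq_pow_sum, hK]
    simp [σ, Finset.sum_range_succ, pow_add, mul_comm]
  apply (algebraMap F K).injective
  rw [hnorm, map_add σ, map_mul σ, σ.commutes, σ.commutes, hσi, map_add, map_pow, map_pow]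
  linear_combination -(algebraMap F K y) ^ 2 * hi

theorem norm_one_sub_pow_four [Finite K] (hq : Fintype.card F % 4 = 3)
    (hK : Module.finrank F K = 2) {i : K} (hi : i ^ 2 = -1) (x y : F) :
    Algebra.norm F (1 - (algebraMap F K x + algebraMap F K y * i) ^ 4) =
      ((x ^ 2 + y ^ 2 + 1) ^ 2 - 4 * x ^ 2) * ((x ^ 2 + y ^ 2 + 1) ^ 2 - 4 * y ^ 2) := by
  have factor : 1 - (algebraMap F K x + algebraMap F K y * i) ^ 4 =
      (algebraMap F K (1 - x) + algebraMap F K (-y) * i) *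
        (algebraMap F K (1 + x) + algebraMap F K y * i) *
        ((algebraMap F K (1 + y) + algebraMap F K (-x) * i) *
          (algebraMap F K (1 - y) + algebraMap F K x * i)) := by
    simp only [map_add, map_sub, map_neg, map_one]
    grind
  rw [factor]
  simp only [map_mul (Algebra.norm F), norm_algebraMap_add_mul hq hK hi]
  ring

theorem sum_norm_eq_sum_sum [Fintype K] {R : Type*} [CommRing R]
    (hq : Fintype.card F % 4 = 3) (hK : Module.finrank F K = 2) (χ E : MulChar F R) :
    ∑ s : K, χ (Algebra.norm F s) * E (Algebra.norm F (1 - s ^ 4)) =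
      ∑ x : F, ∑ y : F, χ (x ^ 2 + y ^ 2) *
        E (((x ^ 2 + y ^ 2 + 1) ^ 2 - 4 * x ^ 2) * ((x ^ 2 + y ^ 2 + 1) ^ 2 - 4 * y ^ 2)) := by
  obtain ⟨i, hi⟩ := exists_sq_eq_neg_one (F := F) (K := K) hK
  rw [← (bijective_algebraMap_add_mul hK (notMem_range_algebraMap hq hi)).sum_comp,
    Fintype.sum_prod_type]
  simp only [norm_algebraMap_add_mul hq hK hi, norm_one_sub_pow_four hq hK hi]

end QuadraticExtension

section MainTheorem

variable {F K : Type*} [Field F] [Fintype F] [DecidableEq F] [Field K] [Algebra F K]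

theorem pow_four_eq_normChar_phi [Finite K] (hF : ringChar F ≠ 2) {M : MulChar K ℂ}
    (hM : orderOf M = 8) : M ^ 4 = normChar K (phi F) := by
  refine eq_of_orderOf_eq_two ?_ ((orderOf_normChar _).trans (orderOf_phi hF))
  rw [orderOf_pow, hM]
  norm_num

variable [Fintype K]

theorem two_mul_jacobiSum_add_jacobiSum (hq : Fintype.card F % 4 = 3) {M : MulChar K ℂ}
    (hM : orderOf M = 8) (ν E : MulChar F ℂ) :
    2 * (jacobiSum (normChar K ν * M) (normChar K E) +
        jacobiSum (normChar K ν * M ^ 5) (normChar K E)) =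
      ∑ s : K, (phi F * ν ^ 4) (Algebra.norm F s) * E (Algebra.norm F (1 - s ^ 4)) := by
  have hM2 : orderOf (M ^ 2) = 4 := by
    rw [orderOf_pow, hM]
    norm_num
  have apply_pow_four (s : K) :
      (normChar K ν * M) (s ^ 4) = (phi F * ν ^ 4) (Algebra.norm F s) := by
    have hM4 : M (s ^ 4) = phi F (Algebra.norm F s) := by
      rw [map_pow, ← MulChar.pow_apply' M four_ne_zero,
        pow_four_eq_normChar_phi (ringChar_ne_two_of_card hq) hM, normChar_apply]
    rw [MulChar.mul_apply, hM4, normChar_apply, map_pow, map_pow, MulChar.mul_apply,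
      MulChar.pow_apply' ν four_ne_zero, mul_comm]
  have h := sum_jacobiSum_mul_pow (normChar K ν * M) (normChar K E) (M ^ 2)
  simp only [hM2, apply_pow_four, normChar_apply, Finset.sum_range_succ, Finset.sum_range_zero,
    mul_assoc, ← pow_mul, ← pow_succ'] at h
  rw [← h, two_mul]
  nth_rw 2 [jacobiSum_normChar_mul_add_frobenius hq hM]
  norm_num
  ring

theorem jacobiSum_add_jacobiSum_eq_sum (hq : Fintype.card F % 4 = 3)
    (hK : Module.finrank F K = 2) {M : MulChar K ℂ} (hM : orderOf M = 8) (ν E : MulChar F ℂ) :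
    jacobiSum (normChar K ν * M) (normChar K E) +
        jacobiSum (normChar K ν * M ^ 5) (normChar K E) =
      ∑ j : Fˣ, (phi F * ν ^ 4) j *
        ∑ x, phi F x * E (((j + 1 : F) ^ 2 - 4 * x) * ((j - 1 : F) ^ 2 + 4 * x)) := by
  set χ := phi F * ν ^ 4
  have hodd : Function.Odd χ := phi_mul_pow_four_odd hq ν
  have hF := ringChar_ne_two_of_card hq
  refine mul_left_cancel₀ two_ne_zero ?_
  rw [two_mul_jacobiSum_add_jacobiSum hq hM, sum_norm_eq_sum_sum hq hK,
    sum_sum_comp_sq_of_odd (orderOf_phi hF) (phi_odd hq)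
      (H := fun x y => χ (x + y) * E (((x + y + 1) ^ 2 - 4 * x) * ((x + y + 1) ^ 2 - 4 * y)))
      (fun x y => by rw [add_comm y x, mul_comm (_ - 4 * y)])
      (fun x y => by rw [← neg_add, hodd, neg_mul]; ring_nf),
    sum_units_eq_sum_sub (fun j : F => χ j *
      ∑ x, phi F x * E (((j + 1) ^ 2 - 4 * x) * ((j - 1) ^ 2 + 4 * x))),
    MulChar.map_zero, zero_mul, sub_zero]
  congr 1
  simp only [Finset.mul_sum]
  rw [Finset.sum_comm (γ := F) (f := fun j x => χ j * _)]
  refine Finset.sum_congr rfl fun x _ => Fintype.sum_equiv (Equiv.addLeft x) _ _ fun y => ?_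
  rw [Equiv.coe_addLeft, mul_left_comm,
    show (x + y - 1) ^ 2 + 4 * x = (x + y + 1) ^ 2 - 4 * y by ring]

theorem hSum_eq_sum (D : MulChar F ℂ) (j : Fˣ) :
    hSum D j = ∑ x, D x * phi F (1 - x) *
      (phi F * D⁻¹ ^ 2) (x * (j + 1 : F) ^ 2 + (j - 1 : F) ^ 2) := by
  rw [hSum, sum_units_eq_sum_sub fun x : F => D x * phi F (1 - x) *
    (phi F * D⁻¹ ^ 2) (x * (j + 1 : F) ^ 2 + (j - 1 : F) ^ 2)]
  simp [MulChar.map_zero]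

theorem gaussSum_mul_hSum (hq : Fintype.card F % 4 = 3) (ψ : AddChar F ℂ) {D : MulChar F ℂ}
    (hD : D ≠ 1) (j : Fˣ) :
    gaussSum (phi F) ψ * gaussSum (phi F * D ^ 2) ψ * hSum D j =
      gaussSum D ψ ^ 2 *
        ∑ x, phi F x * D⁻¹ (((j + 1 : F) ^ 2 - 4 * x) * ((j - 1 : F) ^ 2 + 4 * x)) := by
  have hF := ringChar_ne_two_of_card hq
  have h2 : (2 : F) ≠ 0 := Ring.two_ne_zero hF
  have four_eq : (4 : F) = 2 ^ 2 := by norm_num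
  have rescale : ∑ x, phi F x * D⁻¹ (((j + 1 : F) ^ 2 - 4 * x) * ((j - 1 : F) ^ 2 + 4 * x)) =
      ∑ x, phi F x * (D⁻¹ ((j + 1 : F) ^ 2 - x) * D⁻¹ ((j - 1 : F) ^ 2 + x)) :=
    Fintype.sum_equiv (Equiv.mulLeft₀ (4 : F) (four_eq ▸ pow_ne_zero 2 h2)) _ _ fun x => by
      rw [Equiv.mulLeft₀_apply, map_mul D⁻¹, map_mul (phi F), four_eq, phi_apply_sq h2, one_mul]
  have h := gaussSum_mul_sum_eq_gaussSum_mul_sum (phi_ne_one hF) hD hD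
    (by rw [mul_assoc, ← sq]; exact phi_mul_sq_ne_one hq D) ψ ((j + 1 : F) ^ 2) ((j - 1 : F) ^ 2)
  rwa [mul_assoc (phi F) D D, ← sq D, mul_inv, ← inv_pow, phi_isQuadratic.inv, ← hSum_eq_sum,
    ← rescale, ← sq] at h

theorem hSum_eq (hq : Fintype.card F % 4 = 3) {ψ : AddChar F ℂ} (hψ : ψ.IsPrimitive)
    {D : MulChar F ℂ} (hD : D ≠ 1) (j : Fˣ) :
    hSum D j = -(gaussSum (phi F) ψ * gaussSum D ψ ^ 2) /
        ((Fintype.card F : ℂ) * gaussSum (phi F * D ^ 2) ψ) *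
      ∑ x, phi F x * D⁻¹ (((j + 1 : F) ^ 2 - 4 * x) * ((j - 1 : F) ^ 2 + 4 * x)) := by
  have hcard : (Fintype.card F : ℂ) ≠ 0 := Nat.cast_ne_zero.2 Fintype.card_ne_zero
  have hG := gaussSum_ne_zero_of_nontrivial hcard (phi_mul_sq_ne_one hq D) hψ
  have gaussSum_phi_sq : gaussSum (phi F) ψ ^ 2 = -Fintype.card F := by
    rw [gaussSum_sq (phi_ne_one (ringChar_ne_two_of_card hq)) phi_isQuadratic hψ, phi_odd hq,
      map_one, neg_one_mul]
  rw [div_mul_eq_mul_div, eq_div_iff (mul_ne_zero hcard hG)]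
  linear_combination -gaussSum (phi F) ψ * gaussSum_mul_hSum hq ψ hD j +
    gaussSum (phi F * D ^ 2) ψ * hSum D j * gaussSum_phi_sq

theorem hSum_one (hq : Fintype.card F % 4 = 3) (j : Fˣ) :
    hSum 1 j = phi F ((j + 1 : F) ^ 2) - phi F ((j - 1 : F) ^ 2) := by
  have hF := ringChar_ne_two_of_card hq
  have hj : (j + 1 : F) ^ 2 + (j - 1 : F) ^ 2 ≠ 0 := by
    rw [show (j + 1 : F) ^ 2 + (j - 1 : F) ^ 2 = 2 * ((j : F) ^ 2 + 1) by ring]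
    refine mul_ne_zero (Ring.two_ne_zero hF) fun h => ?_
    exact FiniteField.isSquare_neg_one_iff.1 ⟨(j : F), by linear_combination -h⟩ hq
  have h := sum_mulChar_one_sub_mul_inv (phi_ne_one hF) hj
  rw [phi_isQuadratic.inv, phi_odd hq, neg_neg] at h
  rw [← h, hSum]
  simp only [MulChar.one_apply_coe, inv_one, one_pow, mul_one, one_mul]
  rw [sum_units_eq_sum_sub fun x => phi F (1 - x) * phi F (x * (j + 1 : F) ^ 2 + (j - 1 : F) ^ 2)]
  simp

theorem wSum_one (hq : Fintype.card F % 4 = 3) (ν : MulChar F ℂ) : wSum ν 1 = 2 := by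
  have phi_sq_apply (a : F) : phi F (a ^ 2) = 1 - if a = 0 then 1 else 0 := by
    split_ifs with h
    · simp [h, MulChar.map_zero]
    · rw [phi_apply_sq h, sub_zero]
  have sum_shift (a : Fˣ) :
      ∑ j : Fˣ, (phi F * ν ^ 4) j * (if (j : F) - a = 0 then 1 else 0) = (phi F * ν ^ 4) a := by
    simp [sub_eq_zero, Units.val_inj]
  have h1 := sum_shift 1
  have h2 := sum_shift (-1)
  rw [Units.val_neg, Units.val_one, phi_mul_pow_four_odd hq, map_one] at h2
  rw [Units.val_one, map_one] at h1
  simp only [sub_neg_eq_add] at h2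
  simp only [wSum, hSum_one hq, phi_sq_apply, sub_sub_sub_cancel_left, mul_sub,
    Finset.sum_sub_distrib, h1, h2]
  norm_num

theorem psi_isPrimitive (p : ℕ) [Fact p.Prime] (F : Type*) [Field F] [Finite F]
    [Algebra (ZMod p) F] : (psi p F).IsPrimitive := by
  refine AddChar.IsPrimitive.of_ne_one fun h => ?_
  obtain ⟨b, hb⟩ := Algebra.trace_surjective (ZMod p) F 1
  have h1 : ZMod.stdAddChar (1 : ZMod p) = ZMod.stdAddChar (0 : ZMod p) := by
    rw [AddChar.map_zero_eq_one, ← hb]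
    exact DFunLike.congr_fun h b
  exact one_ne_zero (ZMod.injective_stdAddChar h1)

theorem theorem5p3_general (hq : Fintype.card F % 4 = 3) (hK : Module.finrank F K = 2)
    {ψ : AddChar F ℂ} (hψ : ψ.IsPrimitive) {M₈ : MulChar K ℂ} (hM₈ : orderOf M₈ = 8)
    (ν₁ : MulChar F ℂ) :
    wSum ν₁ 1 = 2 ∧
    ∀ D : MulChar F ℂ, D ≠ 1 →
      wSum ν₁ D =
        -(gaussSum (phi F) ψ * gaussSum D ψ ^ 2) /
            ((Fintype.card F : ℂ) * gaussSum (phi F * D ^ 2) ψ) *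
          (jacobiSum (normChar K ν₁ * M₈) (normChar K D⁻¹) +
            jacobiSum (normChar K ν₁ * M₈ ^ 5) (normChar K D⁻¹)) := by
  refine ⟨wSum_one hq ν₁, fun D hD => ?_⟩
  simp only [wSum, hSum_eq hq hψ hD, mul_left_comm _ (_ / _)]
  rw [jacobiSum_add_jacobiSum_eq_sum hq hK hM₈, Finset.mul_sum]

end MainTheorem

theorem theorem5p3 {F K : Type*} [Field F] [Fintype F] [DecidableEq F] [Field K] [Fintype K]
    [Algebra F K] (p : ℕ) [Fact p.Prime] [Algebra (ZMod p) F]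
    (hq : Fintype.card F % 4 = 3) (hK : Module.finrank F K = 2)
    (M₈ : MulChar K ℂ) (hM₈ : orderOf M₈ = 8) (ν₁ : MulChar F ℂ) :
    wSum ν₁ 1 = 2 ∧
    ∀ D : MulChar F ℂ, D ≠ 1 →
      wSum ν₁ D =
        -(gaussG p (phi F) * gaussG p D ^ 2) /
            ((Fintype.card F : ℂ) * gaussG p (phi F * D ^ 2)) *
          (jacobiSum (normChar K ν₁ * M₈) (normChar K D⁻¹) +
            jacobiSum (normChar K ν₁ * M₈ ^ 5) (normChar K D⁻¹)) :=
  theorem5p3_general hq hK (psi_isPrimitive p F) hM₈ ν₁
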